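/- Let $G$ be a finite group and let $T$ be a $G$-Tambara functor, with commutative rings $T(G/H)$ for $H\le G$, restrictions $r^H_K$, transfers $t^H_K$, norms $N^H_K$ (for $K\le H$) and conjugations $c_g$. A \emph{Tambara ideal} $I$ of $T$ is a family of ideals $I(G/H)\subseteq T(G/H)$ closed under restrictions, transfers and norms and satisfying $c_g(I(G/H))=I(G/gHg^{-1})$; Tambara ideals are ordered by levelwise inclusion. For $x\in T(G/H)$ let $\langle x\rangle$ be the smallest Tambara ideal containing $x$; the product $IJ$ is the Tambara ideal generated by the levelwise products $I(G/H)\cdot J(G/H)$. The ideal $I$ is \emph{radical} if $I=\sqrt I$, where $(\sqrt I)(G/H)=\{x\in T(G/H) : \langle x\rangle^n\subseteq I \text{ for some } n\ge 1\}$. A \emph{Nakaoka prime} is a Tambara ideal $P$ with $1\notin P(G/G)$ such that, for all Tambara ideals $I,J$, $IJ\subseteq P$ implies $I\subseteq P$ or $J\subseteq P$. Let $\mathrm{RadId}_G(T)$ be the set of radical Tambara ideals of $T$, ordered by inclusion; it is a complete lattice whose meets are levelwise intersections. \textbf{Theorem.} $\mathrm{RadId}_G(T)$ is a frame, i.e.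 $K\wedge\bigvee_\lambda J_\lambda=\bigvee_\lambda (K\wedge J_\lambda)$ for all $K$ and all families $(J_\lambda)$, and this frame is spatial: writing $\mathrm{pt}(A)$ for the space of frame homomorphisms $p\colon A\to\{0<1\}$, with open sets $U(a)=\{p : p(a)=1\}$ for $a\in A$, the canonical map $a\mapsto U(a)$ is an isomorphism from $A=\mathrm{RadId}_G(T)$ onto the frame of open sets of $\mathrm{pt}(A)$. Moreover, if $I,J$ are radical Tambara ideals with $I\not\subseteq J$, there is a Nakaoka prime $P$ with $J\subseteq P$ and $I\not\subseteq P$; in particular, for any two distinct radical Tambara ideals some Nakaoka prime contains exactly one of them. Equivalently, every radical Tambara ideal is the intersection of the Nakaoka primes containing it (the empty intersection being the unit ideal $T$). -/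

import Mathlib

open scoped Pointwise

universe v u

/-- The data (levels, restrictions, transfers, norms, conjugations) of a `G`-Tambara functor,
before the axioms.  `obj H` is `T(G/H)`.  The conjugation `T(G/H) ≅ T(G/gHg⁻¹)` takes its target
subgroup `K` together with a proof of `K = gHg⁻¹`, to avoid transports between equal subgroups. -/
structure TambaraData (G : Type v) [Group G] where
  obj : Subgroup G → Type u
  [commRing : ∀ H, CommRing (obj H)]
  res {K H : Subgroup G} (h : K ≤ H) : obj H →+* obj K
  tr {K H : Subgroup G} (h : K ≤ H) : obj K →+ obj H
  nm {K H : Subgroup G} (h : K ≤ H) : obj K →* obj H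
  conj (g : G) (H K : Subgroup G) (h : K = MulAut.conj g • H) : obj H ≃+* obj K

attribute [instance] TambaraData.commRing

namespace TambaraData

variable {G : Type v} [Group G] (D : TambaraData.{v, u} G)

/-- The coset space `K/H`, as a set of cosets in `G/H` (used for `H ≤ K`). -/
def cosetsIn (K H : Subgroup G) : Set (G ⧸ H) := {x | ∃ k ∈ K, x = (k : G ⧸ H)}

/-- For a coset `x = γH`, the element `r (c_γ a)` of `T(G/(S ∩ γHγ⁻¹))`, where `a ∈ T(G/H)`. -/
noncomputable def resConj (S : Subgroup G) {H : Subgroup G} (x : G ⧸ H) (a : D.obj H) :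
    D.obj (S ⊓ MulAut.conj x.out • H) :=
  D.res inf_le_right (D.conj x.out H (MulAut.conj x.out • H) rfl a)

/-- For an `S`-stable set `A` of cosets `γH`, the sum over the `S`-orbits `[γH]` in `A` of
`t^S_{S ∩ γHγ⁻¹} (r (c_γ a))`. For `A = K/H` and `S ≤ K`, the `S`-orbits in `A` are the
double cosets `S\K/H`. -/
noncomputable def trSum (S : Subgroup G) {H : Subgroup G} (A : Set (G ⧸ H)) (a : D.obj H) :
    D.obj S :=
  ∑ᶠ (q : MulAction.orbitRel.Quotient S (G ⧸ H)) (_ : q.out ∈ A),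
    D.tr inf_le_left (D.resConj S q.out a)

/-- For an `S`-stable set `A` of cosets `γH`, the product over the `S`-orbits `[γH]` in `A` of
`N^S_{S ∩ γHγ⁻¹} (r (c_γ a))`. -/
noncomputable def nmProd (S : Subgroup G) {H : Subgroup G} (A : Set (G ⧸ H)) (a : D.obj H) :
    D.obj S :=
  ∏ᶠ (q : MulAction.orbitRel.Quotient S (G ⧸ H)) (_ : q.out ∈ A),
    D.nm inf_le_left (D.resConj S q.out a)

/-- The stabilizer in `K` of a set of cosets. -/
def stab (K : Subgroup G) {H : Subgroup G} (A : Set (G ⧸ H)) : Subgroup G :=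
  K ⊓ MulAction.stabilizer G A

theorem stab_le (K : Subgroup G) {H : Subgroup G} (A : Set (G ⧸ H)) : stab K A ≤ K :=
  inf_le_left

end TambaraData

/-- A `G`-Tambara functor, for a finite group `G`. -/
structure TambaraFunctor (G : Type v) [Group G] [Finite G] extends TambaraData.{v, u} G where
  -- functoriality
  res_refl (H : Subgroup G) (x : obj H) : res (le_refl H) x = x
  tr_refl (H : Subgroup G) (x : obj H) : tr (le_refl H) x = x
  nm_refl (H : Subgroup G) (x : obj H) : nm (le_refl H) x = x
  conj_of_mem (H : Subgroup G) (h : G) (_ : h ∈ H) (e : H = MulAut.conj h • H) (x : obj H) :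
    conj h H H e x = x
  res_res {L K H : Subgroup G} (h₁ : L ≤ K) (h₂ : K ≤ H) (x : obj H) :
    res h₁ (res h₂ x) = res (h₁.trans h₂) x
  tr_tr {L K H : Subgroup G} (h₁ : L ≤ K) (h₂ : K ≤ H) (x : obj L) :
    tr h₂ (tr h₁ x) = tr (h₁.trans h₂) x
  nm_nm {L K H : Subgroup G} (h₁ : L ≤ K) (h₂ : K ≤ H) (x : obj L) :
    nm h₂ (nm h₁ x) = nm (h₁.trans h₂) x
  conj_conj (g h : G) (H K L : Subgroup G) (e₁ : K = MulAut.conj h • H)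
    (e₂ : L = MulAut.conj g • K) (e₃ : L = MulAut.conj (g * h) • H) (x : obj H) :
    conj g K L e₂ (conj h H K e₁ x) = conj (g * h) H L e₃ x
  -- compatibility with conjugation
  conj_res (g : G) (K H K' H' : Subgroup G) (h : K ≤ H) (h' : K' ≤ H')
    (eK : K' = MulAut.conj g • K) (eH : H' = MulAut.conj g • H) (x : obj H) :
    conj g K K' eK (res h x) = res h' (conj g H H' eH x)
  conj_tr (g : G) (K H K' H' : Subgroup G) (h : K ≤ H) (h' : K' ≤ H')
    (eK : K' = MulAut.conj g • K) (eH : H' = MulAut.conj g • H) (x : obj K) :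
    conj g H H' eH (tr h x) = tr h' (conj g K K' eK x)
  conj_nm (g : G) (K H K' H' : Subgroup G) (h : K ≤ H) (h' : K' ≤ H')
    (eK : K' = MulAut.conj g • K) (eH : H' = MulAut.conj g • H) (x : obj K) :
    conj g H H' eH (nm h x) = nm h' (conj g K K' eK x)
  -- additive and multiplicative double coset formulas
  res_tr {H L K : Subgroup G} (hH : H ≤ K) (hL : L ≤ K) (a : obj H) :
    res hL (tr hH a) = toTambaraData.trSum L (TambaraData.cosetsIn K H) a
  res_nm {H L K : Subgroup G} (hH : H ≤ K) (hL : L ≤ K) (a : obj H) :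
    res hL (nm hH a) = toTambaraData.nmProd L (TambaraData.cosetsIn K H) a
  -- Frobenius reciprocity
  tr_res_mul {K H : Subgroup G} (h : K ≤ H) (x : obj H) (y : obj K) :
    tr h (res h x * y) = x * tr h y
  /-- Tambara reciprocity for sums: the sum is over the `K`-orbits of subsets `A` of `K/H`
  (equivalently of maps `K/H → {a, b}`; the value is `a` on `A` and `b` on its complement). -/
  nm_add {H K : Subgroup G} (h : H ≤ K) (a b : obj H) :
    nm h (a + b) =
      ∑ᶠ (q : MulAction.orbitRel.Quotient K (Set (G ⧸ H)))
        (_ : q.out ⊆ TambaraData.cosetsIn K H),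
        tr (TambaraData.stab_le K q.out)
          (toTambaraData.nmProd (TambaraData.stab K q.out) q.out a *
            toTambaraData.nmProd (TambaraData.stab K q.out)
              (TambaraData.cosetsIn K H \ q.out) b)
  /-- Tambara reciprocity for transfers: the sum is over the `K`-orbits of sections of the
  projection `K/L → K/H`, a section being given by its image `A`, a subset of `K/L`
  that projects bijectively onto `K/H`. -/
  nm_tr {L H K : Subgroup G} (hL : L ≤ H) (hH : H ≤ K) (a : obj L) :
    nm hH (tr hL a) =
      ∑ᶠ (q : MulAction.orbitRel.Quotient K (Set (G ⧸ L)))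
        (_ : Set.BijOn (Subgroup.quotientMapOfLE hL) q.out (TambaraData.cosetsIn K H)),
        tr (TambaraData.stab_le K q.out)
          (toTambaraData.nmProd (TambaraData.stab K q.out) q.out a)

/-- A Tambara ideal. Since the maps `c_g` are bijective, `mem_conj` says
`c_g(I(G/H)) = I(G/gHg⁻¹)`. -/
@[ext]
structure TambaraIdeal {G : Type v} [Group G] [Finite G] (T : TambaraFunctor.{v, u} G) where
  level (H : Subgroup G) : Ideal (T.obj H)
  res_mem {K H : Subgroup G} (h : K ≤ H) {x : T.obj H} : x ∈ level H → T.res h x ∈ level K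
  tr_mem {K H : Subgroup G} (h : K ≤ H) {x : T.obj K} : x ∈ level K → T.tr h x ∈ level H
  nm_mem {K H : Subgroup G} (h : K ≤ H) {x : T.obj K} : x ∈ level K → T.nm h x ∈ level H
  mem_conj (g : G) (H K : Subgroup G) (e : K = MulAut.conj g • H) (x : T.obj H) :
    T.conj g H K e x ∈ level K ↔ x ∈ level H

namespace TambaraIdeal

variable {G : Type v} [Group G] [Finite G] {T : TambaraFunctor.{v, u} G}

/-- Tambara ideals are ordered by levelwise inclusion. -/
instance : PartialOrder (TambaraIdeal T) where
  le I J := ∀ H, I.level H ≤ J.level H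
  le_refl _ _ := le_rfl
  le_trans _ _ _ h₁ h₂ H := (h₁ H).trans (h₂ H)
  le_antisymm _ _ h₁ h₂ := TambaraIdeal.ext (funext fun H => le_antisymm (h₁ H) (h₂ H))

/-- Levelwise intersection. -/
instance : InfSet (TambaraIdeal T) where
  sInf S :=
    { level := fun H => ⨅ I ∈ S, I.level H
      res_mem := fun h x hx => by
        simp only [Submodule.mem_iInf] at hx ⊢
        exact fun I hI => I.res_mem h (hx I hI)
      tr_mem := fun h x hx => by
        simp only [Submodule.mem_iInf] at hx ⊢
        exact fun I hI => I.tr_mem h (hx I hI)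
      nm_mem := fun h x hx => by
        simp only [Submodule.mem_iInf] at hx ⊢
        exact fun I hI => I.nm_mem h (hx I hI)
      mem_conj := fun g H K e x => by
        simp only [Submodule.mem_iInf, TambaraIdeal.mem_conj] }

theorem isGLB_sInf' (S : Set (TambaraIdeal T)) : IsGLB S (sInf S) :=
  ⟨fun _ hI _ => iInf₂_le _ hI, fun _ hJ H => le_iInf₂ fun _ hI => hJ hI H⟩

instance : CompleteLattice (TambaraIdeal T) := completeLatticeOfInf _ isGLB_sInf'

/-- The Tambara ideal generated by sets of elements at each level. -/
def generate (X : ∀ H, Set (T.obj H)) : TambaraIdeal T :=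
  sInf {I | ∀ H, X H ⊆ I.level H}

/-- The Tambara ideal `⟨x⟩` generated by `x ∈ T(G/H)`. -/
def principal (H : Subgroup G) (x : T.obj H) : TambaraIdeal T :=
  sInf {I | x ∈ I.level H}

/-- The product `IJ`: the Tambara ideal generated by the levelwise products. -/
instance : Mul (TambaraIdeal T) where
  mul I J := generate fun H => ((I.level H * J.level H : Ideal (T.obj H)) : Set (T.obj H))

/-- The `n`-fold ideal product `I ⋯ I`, with the unit ideal for `n = 0`
(note that `⊤ * I = I`). -/
def npow (I : TambaraIdeal T) : ℕ → TambaraIdeal T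
  | 0 => ⊤
  | n + 1 => npow I n * I

/-- The radical `√I`, level by level. -/
def radical (I : TambaraIdeal T) (H : Subgroup G) : Set (T.obj H) :=
  {x | ∃ n : ℕ, 1 ≤ n ∧ (principal H x).npow n ≤ I}

/-- `I` is radical if `I = √I`. -/
def IsRadical (I : TambaraIdeal T) : Prop :=
  ∀ H, (I.level H : Set (T.obj H)) = I.radical H

/-- `I` is proper if `1 ∉ I(G/G)`. -/
def IsProper (I : TambaraIdeal T) : Prop :=
  (1 : T.obj ⊤) ∉ I.level ⊤

/-- Prime Tambara ideals (Nakaoka primes). -/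
def IsPrime (P : TambaraIdeal T) : Prop :=
  P.IsProper ∧ ∀ I J : TambaraIdeal T, I * J ≤ P → I ≤ P ∨ J ≤ P

theorem top_mul_le (I : TambaraIdeal T) : ⊤ * I ≤ I := by
  have hI : I ∈ {J : TambaraIdeal T | ∀ H,
      (((⊤ : TambaraIdeal T).level H * I.level H : Ideal (T.obj H)) : Set (T.obj H)) ⊆
        J.level H} := fun H _ hx =>
    (Ideal.mul_le_right : (⊤ : TambaraIdeal T).level H * I.level H ≤ I.level H) hx
  exact (isGLB_sInf' _).1 hI

theorem isRadical_iff (I : TambaraIdeal T) :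
    I.IsRadical ↔ ∀ H (x : T.obj H) (n : ℕ), 1 ≤ n → (principal H x).npow n ≤ I →
      x ∈ I.level H := by
  constructor
  · intro h H x n hn hx
    have hx' : x ∈ I.radical H := ⟨n, hn, hx⟩
    rw [← h H] at hx'
    exact hx'
  · intro h H
    ext x
    refine ⟨fun hx => ⟨1, le_rfl, ?_⟩, fun ⟨n, hn, hx⟩ => h H x n hn hx⟩
    exact (top_mul_le _).trans ((isGLB_sInf' _).1 hx)

theorem IsRadical.sInf {S : Set (TambaraIdeal T)} (hS : ∀ I ∈ S, I.IsRadical) :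
    (sInf S).IsRadical := by
  rw [isRadical_iff]
  intro H x n hn hx
  have : ∀ I ∈ S, x ∈ I.level H := fun I hI =>
    (isRadical_iff I).1 (hS I hI) H x n hn (hx.trans ((isGLB_sInf' S).1 hI))
  change x ∈ ⨅ I ∈ S, I.level H
  simpa only [Submodule.mem_iInf] using this

end TambaraIdeal

/-- `RadId_G(T)`: the radical Tambara ideals of `T`, ordered by inclusion. -/
def RadId {G : Type v} [Group G] [Finite G] (T : TambaraFunctor.{v, u} G) :=
  {I : TambaraIdeal T // I.IsRadical}

namespace RadId

variable {G : Type v} [Group G] [Finite G] {T : TambaraFunctor.{v, u} G}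

instance : PartialOrder (RadId T) :=
  inferInstanceAs (PartialOrder {I : TambaraIdeal T // I.IsRadical})

/-- Meets are levelwise intersections. -/
instance : InfSet (RadId T) where
  sInf S := ⟨sInf (Subtype.val '' S), TambaraIdeal.IsRadical.sInf (by
    rintro _ ⟨I, _, rfl⟩
    exact I.2)⟩

theorem isGLB_sInf' (S : Set (RadId T)) : IsGLB S (sInf S) :=
  ⟨fun I hI => (TambaraIdeal.isGLB_sInf' (Subtype.val '' S)).1 ⟨I, hI, rfl⟩,
    fun J hJ => (TambaraIdeal.isGLB_sInf' (Subtype.val '' S)).2 (by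
      rintro _ ⟨I, hI, rfl⟩
      exact hJ hI)⟩

/-- The complete lattice structure: all meets exist, hence also all joins. -/
instance : CompleteLattice (RadId T) := completeLatticeOfInf _ isGLB_sInf'

end RadId

/-- The frame law: binary meets distribute over arbitrary joins. -/
def IsFrame (A : Type*) [CompleteLattice A] : Prop :=
  ∀ (a : A) (S : Set A), a ⊓ sSup S = ⨆ b ∈ S, a ⊓ b

/-- `A` is spatial if the canonical map `a ↦ U(a) = {p | p(a) = 1}` from `A` to the lattice of
open sets of its space of points is an isomorphism. -/
def IsSpatial (A : Type*) [CompleteLattice A] : Prop :=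
  ∃ e : A ≃o TopologicalSpace.Opens (Locale.PT A),
    ∀ a : A, (e a : Set (Locale.PT A)) = {p | p a}

/-! Everything reduces to separation: if `J` is radical and `I ⊄ J`, some prime contains `J` but not
`I`. The argument is that of m-sequences in noncommutative ring theory, the sequence replacing the
powers of an element. A radical ideal is semiprime, so from `x₀ ∈ I \ J` one can keep choosing `xₙ₊₁
∈ ⟨xₙ⟩² \ J`. Zorn gives `P ⊇ J` maximal among the ideals avoiding every `xₙ`. If `A, B ⊄ P`, then
`P + A` and `P + B` contain all late terms, so `(P + A)(P + B)` does too; this product lies in `P`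
if `AB` does, hence `P` is prime.

The Tambara input is that the levelwise sum of two ideals is again an ideal (`nm_add_mem_sup`, from
Tambara reciprocity). Separation then yields enough points: inequalities of radical ideals can be
tested on primes, where meets and joins become "or" and "for all". -/

namespace TambaraData

variable {G : Type v} [Group G] {D : TambaraData.{v, u} G}

theorem smul_mem_cosetsIn {K H : Subgroup G} {g : G} (hg : g ∈ K) {x : G ⧸ H}
    (hx : x ∈ cosetsIn K H) : g • x ∈ cosetsIn K H := by
  obtain ⟨k, hk, rfl⟩ := hx
  exact ⟨g * k, K.mul_mem hg hk, rfl⟩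

/-- If `A` is `S`-stable and nonempty, then `nmProd S A a` is a product with a factor indexed by an
orbit in `A`; hence it lies in any ideal that contains all the factors. -/
theorem nmProd_mem [Finite G] {S H : Subgroup G} {A : Set (G ⧸ H)} {a : D.obj H}
    (hA : ∀ s ∈ S, ∀ x ∈ A, s • x ∈ A) (hne : A.Nonempty) (I : Ideal (D.obj S))
    (hI : ∀ x : G ⧸ H, D.nm inf_le_left (D.resConj S x a) ∈ I) : D.nmProd S A a ∈ I := by
  classical
  obtain ⟨x, hx⟩ := hne
  -- The chosen representative need not be `x`, but it lies in the orbit of `x`, hence in `A`.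
  have hq : (Quotient.mk'' x : MulAction.orbitRel.Quotient S (G ⧸ H)).out ∈ A := by
    have h := Quotient.mk_out (s := MulAction.orbitRel S (G ⧸ H)) x
    obtain ⟨s, hs⟩ := MulAction.orbitRel_apply.1 h
    have := hA s s.2 x hx
    exact hs ▸ this
  have : Fintype (MulAction.orbitRel.Quotient S (G ⧸ H)) := Fintype.ofFinite _
  rw [nmProd, finprod_eq_prod_of_fintype]
  refine Ideal.mem_of_dvd _ (Finset.dvd_prod_of_mem _ (Finset.mem_univ (Quotient.mk'' x))) ?_
  rw [finprod_eq_if, if_pos hq]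
  exact hI _

end TambaraData

/-! ### Levelwise sums and directed unions -/

namespace TambaraIdeal

variable {G : Type v} [Group G] [Finite G] {T : TambaraFunctor.{v, u} G}

theorem nm_resConj_mem (I : TambaraIdeal T) (S : Subgroup G) {H : Subgroup G} {a : T.obj H}
    (ha : a ∈ I.level H) (x : G ⧸ H) :
    T.nm inf_le_left (T.resConj S x a) ∈ I.level S :=
  I.nm_mem _ (I.res_mem _ ((I.mem_conj _ _ _ rfl a).2 ha))

/-- The norm of a sum lies in the levelwise sum of two Tambara ideals. -/
theorem nm_add_mem_sup (I J : TambaraIdeal T) {H K : Subgroup G} (h : H ≤ K) {a b : T.obj H}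
    (ha : a ∈ I.level H) (hb : b ∈ J.level H) : T.nm h (a + b) ∈ I.level K ⊔ J.level K := by
  rw [T.nm_add]
  refine finsum_induction (· ∈ I.level K ⊔ J.level K) (zero_mem _) (fun _ _ => add_mem) fun q => ?_
  refine finsum_induction (· ∈ I.level K ⊔ J.level K) (zero_mem _) (fun _ _ => add_mem) fun _ => ?_
  have hstab : ∀ s ∈ TambaraData.stab K q.out, ∀ x ∈ q.out, s • x ∈ q.out := fun s hs x hx => by
    have hs' : s • q.out = q.out := hs.2
    exact hs' ▸ Set.smul_mem_smul_set hx
  -- The empty subset gives the pure `b`-term, in `J`; any other subset contributes a norm factor of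
  -- `a`, in `I`.
  rcases Set.eq_empty_or_nonempty q.out with he | hne
  · refine Ideal.mem_sup_right (J.tr_mem _ (Ideal.mul_mem_left _ _ ?_))
    refine TambaraData.nmProd_mem (fun s hs x hx => ?_) ?_ _ (J.nm_resConj_mem _ hb)
    · rw [he, Set.sdiff_empty] at hx ⊢
      exact TambaraData.smul_mem_cosetsIn hs.1 hx
    · rw [he, Set.sdiff_empty]
      exact ⟨_, 1, K.one_mem, rfl⟩
  · exact Ideal.mem_sup_left (I.tr_mem _ (Ideal.mul_mem_right _ _
      (TambaraData.nmProd_mem hstab hne _ (I.nm_resConj_mem _ ha))))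

/-- The levelwise sum of two Tambara ideals. -/
def levelSup (I J : TambaraIdeal T) : TambaraIdeal T where
  level H := I.level H ⊔ J.level H
  res_mem h x hx := by
    obtain ⟨a, ha, b, hb, rfl⟩ := Submodule.mem_sup.1 hx
    rw [map_add]
    exact Submodule.add_mem_sup (I.res_mem h ha) (J.res_mem h hb)
  tr_mem h x hx := by
    obtain ⟨a, ha, b, hb, rfl⟩ := Submodule.mem_sup.1 hx
    rw [map_add]
    exact Submodule.add_mem_sup (I.tr_mem h ha) (J.tr_mem h hb)
  nm_mem h x hx := by
    obtain ⟨a, ha, b, hb, rfl⟩ := Submodule.mem_sup.1 hx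
    exact nm_add_mem_sup I J h ha hb
  mem_conj g H K e x := by
    constructor
    · intro hx
      obtain ⟨a, ha, b, hb, hab⟩ := Submodule.mem_sup.1 hx
      obtain ⟨a, rfl⟩ := (T.conj g H K e).surjective a
      obtain ⟨b, rfl⟩ := (T.conj g H K e).surjective b
      rw [← map_add] at hab
      rw [← (T.conj g H K e).injective hab]
      exact Submodule.add_mem_sup ((I.mem_conj _ _ _ _ _).1 ha) ((J.mem_conj _ _ _ _ _).1 hb)
    · intro hx
      obtain ⟨a, ha, b, hb, rfl⟩ := Submodule.mem_sup.1 hx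
      rw [map_add]
      exact Submodule.add_mem_sup ((I.mem_conj _ _ _ _ _).2 ha) ((J.mem_conj _ _ _ _ _).2 hb)

theorem mem_iSup_level {c : Set (TambaraIdeal T)} (hc : DirectedOn (· ≤ ·) c) (hne : c.Nonempty)
    {H : Subgroup G} {x : T.obj H} :
    x ∈ (⨆ I : c, I.1.level H) ↔ ∃ I ∈ c, x ∈ I.level H := by
  have : Nonempty c := hne.to_subtype
  rw [Submodule.mem_iSup_of_directed, Subtype.exists]
  · simp only [exists_prop]
  · intro I J
    obtain ⟨K, hK, hIK, hJK⟩ := hc I.1 I.2 J.1 J.2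
    exact ⟨⟨K, hK⟩, hIK H, hJK H⟩

/-- The levelwise union of a nonempty directed set of Tambara ideals. -/
def directedSup (c : Set (TambaraIdeal T)) (hc : DirectedOn (· ≤ ·) c) (hne : c.Nonempty) :
    TambaraIdeal T where
  level H := ⨆ I : c, I.1.level H
  res_mem h x hx := by
    rw [mem_iSup_level hc hne] at hx ⊢
    exact hx.imp fun I hI => ⟨hI.1, I.res_mem h hI.2⟩
  tr_mem h x hx := by
    rw [mem_iSup_level hc hne] at hx ⊢
    exact hx.imp fun I hI => ⟨hI.1, I.tr_mem h hI.2⟩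
  nm_mem h x hx := by
    rw [mem_iSup_level hc hne] at hx ⊢
    exact hx.imp fun I hI => ⟨hI.1, I.nm_mem h hI.2⟩
  mem_conj g H K e x := by simp only [mem_iSup_level hc hne, TambaraIdeal.mem_conj]

theorem mem_sInf {S : Set (TambaraIdeal T)} {H : Subgroup G} {x : T.obj H} :
    x ∈ (sInf S).level H ↔ ∀ I ∈ S, x ∈ I.level H := by
  change x ∈ ⨅ I ∈ S, I.level H ↔ _
  simp only [Submodule.mem_iInf]

theorem mem_principal (H : Subgroup G) (x : T.obj H) : x ∈ (principal H x).level H :=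
  mem_sInf.2 fun _ hI => hI

/-- The unit Tambara ideal, level by level. -/
def unit (T : TambaraFunctor.{v, u} G) : TambaraIdeal T where
  level _ := ⊤
  res_mem _ _ _ := trivial
  tr_mem _ _ _ := trivial
  nm_mem _ _ _ := trivial
  mem_conj _ _ _ _ _ := Iff.rfl

theorem mem_top (H : Subgroup G) (x : T.obj H) : x ∈ (⊤ : TambaraIdeal T).level H :=
  (le_top : unit T ≤ ⊤) H trivial

/-! ### Products, radicals and primes -/

theorem principal_le {I : TambaraIdeal T} {H : Subgroup G} {x : T.obj H} (hx : x ∈ I.level H) :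
    principal H x ≤ I :=
  (isGLB_sInf' _).1 hx

/-- Minimality of the generated ideal: upper bounds on a product never require describing its
elements. -/
theorem mul_le_iff {I J K : TambaraIdeal T} :
    I * J ≤ K ↔ ∀ H, I.level H * J.level H ≤ K.level H := by
  refine ⟨fun h H x hx => h H ?_, fun h => (isGLB_sInf' _).1 h⟩
  exact mem_sInf.2 fun L hL => hL H hx

theorem mul_mono {I I' J J' : TambaraIdeal T} (hI : I ≤ I') (hJ : J ≤ J') : I * J ≤ I' * J' :=
  mul_le_iff.2 fun H => (Ideal.mul_mono (hI H) (hJ H)).trans (mul_le_iff.1 le_rfl H)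

theorem mul_le_left (I J : TambaraIdeal T) : I * J ≤ I := mul_le_iff.2 fun _ => Ideal.mul_le_left

theorem mul_le_right (I J : TambaraIdeal T) : I * J ≤ J := mul_le_iff.2 fun _ => Ideal.mul_le_right

/-- A radical Tambara ideal is semiprime. -/
theorem IsRadical.le_of_mul_self_le {I J : TambaraIdeal T} (hJ : J.IsRadical) (h : I * I ≤ J) :
    I ≤ J := fun H x hx =>
  (isRadical_iff J).1 hJ H x 2 one_le_two <|
    -- `npow 2` unfolds to `(⊤ * ⟨x⟩) * ⟨x⟩`; the leading `⊤` has to be absorbed.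
    (mul_mono ((top_mul_le _).trans (principal_le hx)) (principal_le hx)).trans h

/-- Restriction preserves `1`, so `1 ∈ I(G/G)` would make every level the unit ideal. -/
theorem IsProper.of_notMem {I : TambaraIdeal T} {H : Subgroup G} {x : T.obj H}
    (hx : x ∉ I.level H) : I.IsProper := fun h => hx <| by
  have := I.res_mem (le_top : H ≤ ⊤) h
  rw [map_one] at this
  rw [(Ideal.eq_top_iff_one _).2 this]
  trivial

theorem IsPrime.isRadical {P : TambaraIdeal T} (hP : P.IsPrime) : P.IsRadical := by
  rw [isRadical_iff]
  intro H x n _ hn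
  suffices h : principal H x ≤ P from h H (mem_principal H x)
  clear * - hP hn
  induction n with
  | zero =>
    have h : (⊤ : TambaraIdeal T) ≤ P := hn
    exact le_top.trans h
  | succ n ih => exact (hP.2 _ _ hn).elim ih id

/-! ### Separation by primes -/

/-- If every element of the sequence `f` lies in the square of the Tambara ideal generated by its
predecessor, then a Tambara ideal that avoids `f` is contained in a prime one that does. -/
theorem exists_isPrime_of_avoids {J : TambaraIdeal T} (f : ℕ → Σ H, T.obj H)
    (hf : ∀ n, (f (n + 1)).2 ∈
      (principal (f n).1 (f n).2 * principal (f n).1 (f n).2).level (f (n + 1)).1)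
    (hJ : ∀ n, (f n).2 ∉ J.level (f n).1) :
    ∃ P : TambaraIdeal T, P.IsPrime ∧ J ≤ P ∧ ∀ n, (f n).2 ∉ P.level (f n).1 := by
  obtain ⟨P, hJP, hP⟩ := zorn_le_nonempty₀
    {I : TambaraIdeal T | ∀ n, (f n).2 ∉ I.level (f n).1}
    (fun c hc hchain I hI => ⟨directedSup c hchain.directedOn ⟨I, hI⟩, fun n hn => by
        obtain ⟨L, hL, hn⟩ := (mem_iSup_level hchain.directedOn ⟨I, hI⟩).1 hn
        exact hc hL n hn,
      fun L hL H x hx => (mem_iSup_level hchain.directedOn ⟨I, hI⟩).2 ⟨L, hL, hx⟩⟩) J hJ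
  -- Since `⟨x⟩² ≤ ⟨x⟩`, an ideal containing one term contains all later ones.
  have hmono : ∀ {A : TambaraIdeal T} {i j : ℕ}, i ≤ j → (f i).2 ∈ A.level (f i).1 →
      (f j).2 ∈ A.level (f j).1 := fun {A i j} hij hi => by
    induction hij with
    | refl => exact hi
    | step _ ih => exact ((mul_le_left _ _).trans (principal_le ih)) _ (hf _)
  have hmeet : ∀ A : TambaraIdeal T, ¬ A ≤ P →
      ∃ n, (f n).2 ∈ (levelSup P A).level (f n).1 := fun A hA => by
    by_contra! h
    exact hA fun H => le_sup_right.trans (hP.2 h (fun H => le_sup_left) H)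
  refine ⟨P, ⟨IsProper.of_notMem (hP.1 0), fun A B hAB => ?_⟩, hJP, hP.1⟩
  by_contra! h
  obtain ⟨i, hi⟩ := hmeet A h.1
  obtain ⟨j, hj⟩ := hmeet B h.2
  refine hP.1 (max i j + 1) ((?_ : _ * _ ≤ P) _ (hf (max i j)))
  refine (mul_mono (principal_le (hmono (le_max_left i j) hi))
    (principal_le (hmono (le_max_right i j) hj))).trans (mul_le_iff.2 fun H => ?_)
  -- Here the sums must be levelwise: expanding leaves only products inside `P` and `A * B`.
  change (P.level H ⊔ A.level H) * (P.level H ⊔ B.level H) ≤ P.level H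
  rw [Ideal.sup_mul, Ideal.mul_sup (A.level H)]
  exact sup_le Ideal.mul_le_left
    (sup_le Ideal.mul_le_right (mul_le_iff.1 hAB H))

/-- Prime Tambara ideals separate a radical Tambara ideal from the ideals it does not contain. -/
theorem IsRadical.exists_isPrime {I J : TambaraIdeal T} (hJ : J.IsRadical) (h : ¬ I ≤ J) :
    ∃ P : TambaraIdeal T, P.IsPrime ∧ J ≤ P ∧ ¬ I ≤ P := by
  have hex : ∃ (H : Subgroup G) (x : T.obj H), x ∈ I.level H ∧ x ∉ J.level H := by
    by_contra! hc
    exact h hc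
  obtain ⟨H, x, hxI, hxJ⟩ := hex
  -- If `⟨p⟩²` had no element outside `J`, semiprimeness would put `p` in `J`.
  have step : ∀ p : {p : Σ H, T.obj H // p.2 ∉ J.level p.1},
      ∃ q : {p : Σ H, T.obj H // p.2 ∉ J.level p.1},
        q.1.2 ∈ (principal p.1.1 p.1.2 * principal p.1.1 p.1.2).level q.1.1 := fun p => by
    by_contra! hc
    refine p.2 ((hJ.le_of_mul_self_le (fun K y hy => ?_) : principal p.1.1 p.1.2 ≤ J) _ ?_)
    · by_contra hyJ
      exact hc ⟨⟨K, y⟩, hyJ⟩ hy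
    · exact mem_principal _ _
  choose next hnext using step
  let f : ℕ → {p : Σ H, T.obj H // p.2 ∉ J.level p.1} := fun n => next^[n] ⟨⟨H, x⟩, hxJ⟩
  obtain ⟨P, hP, hJP, hf⟩ := exists_isPrime_of_avoids (J := J) (fun n => (f n).1)
    (fun n => by
      have h : f (n + 1) = next (f n) := Function.iterate_succ_apply' _ _ _
      rw [h]
      exact hnext _) fun n => (f n).2
  exact ⟨P, hP, hJP, fun hIP => hf 0 (hIP H hxI)⟩

end TambaraIdeal

/-! ### Frame law and spatiality -/

namespace RadId

variable {G : Type v} [Group G] [Finite G] {T : TambaraFunctor.{v, u} G}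

theorem le_of_forall_isPrime {I J : RadId T}
    (h : ∀ P : TambaraIdeal T, P.IsPrime → J.1 ≤ P → I.1 ≤ P) : I ≤ J := by
  by_contra hIJ
  obtain ⟨P, hP, hJP, hIP⟩ := J.2.exists_isPrime (I := I.1) hIJ
  exact hIP (h P hP hJP)

theorem inf_le_isPrime_iff {P : TambaraIdeal T} (hP : P.IsPrime) (I J : RadId T) :
    (I ⊓ J).1 ≤ P ↔ I.1 ≤ P ∨ J.1 ≤ P := by
  constructor
  · intro h
    refine hP.2 _ _ (le_trans ?_ h)
    have : I.1 * J.1 ≤ sInf (Subtype.val '' ({I, J} : Set (RadId T))) := by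
      refine (TambaraIdeal.isGLB_sInf' _).2 ?_
      rintro _ ⟨L, rfl | rfl, rfl⟩
      · exact TambaraIdeal.mul_le_left _ _
      · exact TambaraIdeal.mul_le_right _ _
    exact this.trans (show sInf ({I, J} : Set (RadId T)) ≤ I ⊓ J from
      le_inf ((isGLB_sInf' _).1 (by simp)) ((isGLB_sInf' _).1 (by simp)))
  · rintro (h | h)
    · exact le_trans (show I ⊓ J ≤ I from inf_le_left) h
    · exact le_trans (show I ⊓ J ≤ J from inf_le_right) h

/-- A prime is itself radical, so it competes as an upper bound in `RadId T`; no description of the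
join is needed. -/
theorem sSup_le_isPrime_iff {P : TambaraIdeal T} (hP : P.IsPrime) (S : Set (RadId T)) :
    (sSup S).1 ≤ P ↔ ∀ I ∈ S, I.1 ≤ P :=
  sSup_le_iff (α := RadId T) (a := ⟨P, hP.isRadical⟩)

theorem isFrame : IsFrame (RadId T) := by
  intro K S
  refine le_antisymm (le_of_forall_isPrime fun P hP h => ?_)
    (iSup₂_le fun J hJ => inf_le_inf_left K (le_sSup hJ))
  rw [inf_le_isPrime_iff hP, sSup_le_isPrime_iff hP]
  have hJ : ∀ J ∈ S, K.1 ≤ P ∨ J.1 ≤ P := fun J hJ =>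
    (inf_le_isPrime_iff hP K J).1
      (le_trans (show K ⊓ J ≤ _ from le_iSup₂ (f := fun J (_ : J ∈ S) => K ⊓ J) J hJ) h)
  by_cases hK : K.1 ≤ P
  · exact Or.inl hK
  · exact Or.inr fun J hJS => (hJ J hJS).resolve_left hK

/-- The point of the frame of radical Tambara ideals given by a prime Tambara ideal. -/
def pointOfIsPrime {P : TambaraIdeal T} (hP : P.IsPrime) : Locale.PT (RadId T) where
  toFun I := ¬ I.1 ≤ P
  map_inf' I J := by
    change (¬ _) = ((¬ _) ∧ (¬ _))
    rw [inf_le_isPrime_iff hP, not_or]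
  map_top' := by
    refine eq_true fun h => hP.1 ?_
    have htop : (⊤ : TambaraIdeal T).IsRadical :=
      (TambaraIdeal.isRadical_iff _).2 fun H x n _ _ => TambaraIdeal.mem_top H x
    have hle : (⊤ : TambaraIdeal T) ≤ (⊤ : RadId T).1 := le_top (α := RadId T) (a := ⟨⊤, htop⟩)
    exact hle.trans h ⊤ (TambaraIdeal.mem_top ⊤ 1)
  map_sSup' S := by
    rw [sSup_le_isPrime_iff hP, sSup_image]
    simp

theorem isSpatial : IsSpatial (RadId T) := by
  have hle : ∀ I J : RadId T, {p : Locale.PT (RadId T) | p I} ⊆ {p | p J} ↔ I ≤ J := fun I J => by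
    refine ⟨fun h => le_of_forall_isPrime fun P hP hJ => ?_, fun h p hp =>
      OrderHomClass.mono p h hp⟩
    by_contra hI
    exact (h (show pointOfIsPrime hP ∈ _ from hI) : ¬ _) hJ
  -- The opens are by definition the sets `U(I)`, so surjectivity is free; `hle` carries the
  -- content.
  let e : RadId T → TopologicalSpace.Opens (Locale.PT (RadId T)) := fun I => ⟨{p | p I}, I, rfl⟩
  have he : Function.Surjective e := by
    rintro ⟨_, I, rfl⟩
    exact ⟨I, rfl⟩
  exact ⟨RelIso.ofSurjective (OrderEmbedding.ofMapLEIff e hle) he, fun _ => rfl⟩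

end RadId

theorem mainTheorem2 {G : Type v} [Group G] [Finite G] (T : TambaraFunctor.{v, u} G) :
    IsFrame (RadId T) ∧
      IsSpatial (RadId T) ∧
      (∀ I J : RadId T, ¬ I ≤ J →
        ∃ P : TambaraIdeal T, P.IsPrime ∧ J.1 ≤ P ∧ ¬ I.1 ≤ P) ∧
      (∀ I J : RadId T, I ≠ J →
        ∃ P : TambaraIdeal T, P.IsPrime ∧ ¬ (I.1 ≤ P ↔ J.1 ≤ P)) ∧
      (∀ I : RadId T, I.1 = sInf {P : TambaraIdeal T | P.IsPrime ∧ I.1 ≤ P}) := by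
  have sep : ∀ I J : RadId T, ¬ I ≤ J →
      ∃ P : TambaraIdeal T, P.IsPrime ∧ J.1 ≤ P ∧ ¬ I.1 ≤ P := fun I J h => J.2.exists_isPrime h
  refine ⟨RadId.isFrame, RadId.isSpatial, sep, fun I J h => ?_, fun I => ?_⟩
  · by_cases hIJ : I ≤ J
    · obtain ⟨P, hP, hIP, hJP⟩ := sep J I fun hJI => h (le_antisymm hIJ hJI)
      exact ⟨P, hP, fun hiff => hJP (hiff.1 hIP)⟩
    · obtain ⟨P, hP, hJP, hIP⟩ := sep I J hIJ
      exact ⟨P, hP, fun hiff => hIP (hiff.2 hJP)⟩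
  · refine le_antisymm ((TambaraIdeal.isGLB_sInf' _).2 fun P hP => hP.2) ?_
    exact RadId.le_of_forall_isPrime
      (I := ⟨_, TambaraIdeal.IsRadical.sInf fun P hP => hP.1.isRadical⟩)
      fun P hP hIP => (TambaraIdeal.isGLB_sInf' _).1 ⟨hP, hIP⟩
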